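/- Let $(\Omega,\mathcal F)$ be a standard Borel space and $P$ a nonatomic probability measure on it (for example $(0,1)$ with its Borel $\sigma$-field and Lebesgue measure). A \emph{sub-$\sigma$-field} is a $\sigma$-field $\mathcal E\subset\mathcal F$ containing all $P$-negligible members of $\mathcal F$. Let $\mathrm{S\sigma F}$ be the set of all sub-$\sigma$-fields, with the following topology: $\mathcal E$ is identified with the closed subspace $L_2(\mathcal E)\subset L_2(\Omega,\mathcal F,P)$ of $\mathcal E$-measurable elements, and closed subspaces carry the Wijsman topology, that is, the coarsest topology making $L\mapsto \min(1,\operatorname{dist}(f,L))$ continuous for every $f\in L_2(\Omega,\mathcal F,P)$. A sub-$\sigma$-field $\mathcal E$ is \emph{nonatomic} if every $A\in\mathcal E$ with $P(A)>0$ contains some $B\in\mathcal E$ with $0<P(B)<P(A)$. It is \emph{conditionally nonatomic} if, for $P$-almost every $\omega\in\Omega$, the regular conditional probability measure of $P$ given $\mathcal E$ at $\omega$ is nonatomic. Let $$X_2=\{(\mathcal E_1,\mathcal E_2)\in\mathrm{S\sigma F}\times\mathrm{S\sigma F} : \mathcal E_1\subset\mathcal E_2 \text{ and } \mathcal E_2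 \text{ is conditionally nonatomic}\},$$ with the topology induced from the product. For $(\mathcal E_1,\mathcal E_2)\in X_2$ we say that \emph{$\mathcal E_2|\mathcal E_1$ is nonatomic} if there is a nonatomic sub-$\sigma$-field $\mathcal E_{12}$ such that $\mathcal E_1$ and $\mathcal E_{12}$ are independent and $\mathcal E_2$ is the $\sigma$-field generated by $\mathcal E_1\cup\mathcal E_{12}$. Then the set $\{(\mathcal E_1,\mathcal E_2)\in X_2 : \mathcal E_2|\mathcal E_1 \text{ is nonatomic}\}$ is a $G_\delta$ subset of $X_2$. -/

import Mathlib

open MeasureTheory ProbabilityTheory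

/-- A sub-σ-field of the probability space `(Ω, F, P)`, where `F` is the ambient `MeasurableSpace Ω`:
a σ-field contained in `F` and containing all `P`-negligible members of `F`. -/
structure SubSigmaField {Ω : Type*} [mΩ : MeasurableSpace Ω] (P : Measure Ω) where
  /-- the underlying σ-field -/
  field : MeasurableSpace Ω
  le_ambient : field ≤ mΩ
  null_mem : ∀ s : Set Ω, MeasurableSet[mΩ] s → P s = 0 → MeasurableSet[field] s

/-- The Wijsman embedding of the subsets of a metric space into a space of functions: a set `F` is
sent to its distance function with respect to the metric `min 1 dist` (the constant `1` when `F` is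
empty). -/
noncomputable def wijsmanDist {X : Type*} [PseudoEMetricSpace X] (F : Set X) (x : X) : ENNReal :=
  min 1 (Metric.infEDist x F)

namespace SubSigmaField

variable {Ω : Type*} [mΩ : MeasurableSpace Ω] {P : Measure Ω}

/-- `L₂(E)`: the subspace of `L₂(Ω, F, P)` of the (classes of) `E`-measurable random variables. -/
noncomputable def L2 (E : SubSigmaField P) : Submodule ℝ (Lp ℝ 2 P) :=
  lpMeas ℝ ℝ E.field 2 P

/-- The topology of the space of sub-σ-fields: every sub-σ-field `E` is identified with the closed
subspace `L₂(E)` of `L₂(P)`, and the set of closed subspaces carries the Wijsman topology, that is,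
the topology of pointwise convergence of distance functions. -/
noncomputable instance : TopologicalSpace (SubSigmaField P) :=
  TopologicalSpace.induced
    (fun (E : SubSigmaField P) => wijsmanDist (E.L2 : Set (Lp ℝ 2 P))) inferInstance

/-- `E` is nonatomic: every member of positive probability contains a member of strictly smaller
positive probability. -/
def Nonatomic (E : SubSigmaField P) : Prop :=
  ∀ A : Set Ω, MeasurableSet[E.field] A → 0 < P A →
    ∃ B : Set Ω, MeasurableSet[E.field] B ∧ B ⊆ A ∧ 0 < P B ∧ P B < P A

/-- `E = E₁ × E₂`: the sub-σ-fields `E₁`, `E₂` are independent and `E` is the σ-field generated by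
their union. -/
def IsProduct (E₁ E₂ E : SubSigmaField P) : Prop :=
  Indep E₁.field E₂.field P ∧ E₁.field ⊔ E₂.field = E.field

/-- "`E₂ | E₁` is nonatomic": `E₂ = E₁ × E₁₂` for some nonatomic sub-σ-field `E₁₂`. -/
def NonatomicOver (E₂ E₁ : SubSigmaField P) : Prop :=
  ∃ E₁₂ : SubSigmaField P, E₁₂.Nonatomic ∧ IsProduct E₁ E₁₂ E₂

/-- `E` is conditionally nonatomic: almost all conditional measures of `P` given `E` are nonatomic.
Here `condExpKernel P E.field ω` is the regular conditional probability given `E`, a measure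
on `Ω`. -/
def CondNonatomic [StandardBorelSpace Ω] [IsFiniteMeasure P] (E : SubSigmaField P) : Prop :=
  ∀ᵐ ω ∂P, NullSingletonClass (condExpKernel P E.field ω)

end SubSigmaField

/-- The space `X₂` of pairs `(E₁, E₂)` of sub-σ-fields such that `E₁ ⊆ E₂` and `E₂` is conditionally
nonatomic, with the topology induced from the product. -/
abbrev PairSpace {Ω : Type*} [MeasurableSpace Ω] [StandardBorelSpace Ω] (P : Measure Ω)
    [IsFiniteMeasure P] : Type _ :=
  {p : SubSigmaField P × SubSigmaField P // p.1.field ≤ p.2.field ∧ p.2.CondNonatomic}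

/-! For an event `A`, the second moment of P(A | E) is the squared norm of the projection of the
indicator of `A` onto `L2`, hence by Pythagoras a continuous function of `E` in the Wijsman
topology. So it suffices to express nonatomicity of E₂ | E₁ through countably many strict
inequalities between such energies, each existentially quantified over finite families of events:
this is `nonatomicOver_iff`. If E₂ = E₁ × E₁₂ with E₁₂ nonatomic, cut Ω into N events of E₁₂ of
probability 1/N. Each has energy 1/N over E₂ and 1/N² over E₁, so the total defect is 1 - 1/N.
Conversely, let X and Y generate E₁ and E₂, and let κ be the conditional law of Y given X. The mean
of κ(X){Y}² is at most 1 minus the defect (`integral_sq_atom_le`), so defects close to 1 force κ to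
be nonatomic almost surely. Then U = F(Y | X), with F the conditional distribution function, is
uniform, independent of X, and together with X recovers Y; U generates the required E₁₂
(`nonatomicOver_of_condDistrib`). -/

/-! ### Distribution function of a nonatomic law -/

section CdfTransform

/-- The uniform distribution on the unit interval. -/
noncomputable def uniformUnit : Measure ℝ := volume.restrict (Set.Icc 0 1)

instance : IsProbabilityMeasure uniformUnit := ⟨by simp [uniformUnit]⟩

lemma uniformUnit_Ioc {a b : ℝ} (ha : 0 ≤ a) (hb : b ≤ 1) :
    uniformUnit (Set.Ioc a b) = ENNReal.ofReal (b - a) := by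
  rw [uniformUnit, Measure.restrict_apply measurableSet_Ioc, Set.inter_eq_left.2,
    Real.volume_Ioc]
  exact fun x hx => ⟨ha.trans hx.1.le, hx.2.trans hb⟩

lemma uniformUnit_Iic {t : ℝ} (h1 : t ≤ 1) :
    uniformUnit (Set.Iic t) = ENNReal.ofReal t := by
  rw [uniformUnit, Measure.restrict_apply measurableSet_Iic]
  have : Set.Iic t ∩ Set.Icc 0 1 = Set.Icc 0 t := by
    ext x; simp only [Set.mem_inter_iff, Set.mem_Iic, Set.mem_Icc]; grind
  rw [this, Real.volume_Icc, sub_zero]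

variable (κ : Measure ℝ) [IsProbabilityMeasure κ] [NullSingletonClass κ]

lemma continuous_cdf : Continuous (cdf κ) := by
  rw [continuous_iff_continuousAt]
  intro x
  have h : (cdf κ).measure {x} = 0 := by rw [measure_cdf]; exact measure_singleton x
  rw [StieltjesFunction.measure_singleton, ENNReal.ofReal_eq_zero, sub_nonpos] at h
  have h' : Function.leftLim (cdf κ) x = cdf κ x :=
    le_antisymm ((monotone_cdf κ).leftLim_le le_rfl) h
  exact continuousAt_iff_continuous_left'_right'.2
    ⟨((monotone_cdf κ).continuousWithinAt_Iio_iff_leftLim_eq).2 h',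
      ((cdf κ).right_continuous x).mono Set.Ioi_subset_Ici_self⟩

/-- By continuity the sublevel set is empty (then t ≤ 0) or a half-line ending where the
distribution function equals t; t < 1 keeps it bounded above. -/
lemma measure_cdf_le {t : ℝ} (h1 : t < 1) :
    κ {y | cdf κ y ≤ t} = ENNReal.ofReal t := by
  have hc := continuous_cdf κ
  have hm := monotone_cdf κ
  rcases Set.eq_empty_or_nonempty {y | cdf κ y ≤ t} with he | hne
  · rw [he, measure_empty, eq_comm, ENNReal.ofReal_eq_zero]
    refine ge_of_tendsto' (tendsto_cdf_atBot κ) fun y => ?_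
    by_contra h
    exact (he ▸ (not_le.1 h).le : y ∈ (∅ : Set ℝ))
  obtain ⟨z, hz⟩ := ((tendsto_cdf_atTop κ).eventually (lt_mem_nhds h1)).exists
  have hbdd : BddAbove {y | cdf κ y ≤ t} :=
    ⟨z, fun y (hy : cdf κ y ≤ t) => le_of_lt (hm.reflect_lt (hy.trans_lt hz))⟩
  have hcl : IsClosed {y | cdf κ y ≤ t} := isClosed_le hc continuous_const
  set s := sSup {y | cdf κ y ≤ t} with hs
  have hsm : cdf κ s ≤ t := hcl.csSup_mem hne hbdd
  have hS : {y | cdf κ y ≤ t} = Set.Iic s :=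
    Set.Subset.antisymm (fun y hy => le_csSup hbdd hy) fun y hy => (hm hy).trans hsm
  have hge : t ≤ cdf κ s := by
    refine ge_of_tendsto ((hc.tendsto s).mono_left (nhdsWithin_le_nhds (s := Set.Ioi s))) ?_
    filter_upwards [self_mem_nhdsWithin] with y hy
    by_contra h
    exact absurd (le_csSup hbdd (show cdf κ y ≤ t from (not_le.1 h).le)) (not_le.2 hy)
  rw [hS, ← ofReal_cdf, le_antisymm hsm hge]

/-- The distribution function of a nonatomic law transforms it into the uniform law. -/
lemma map_cdf_eq_uniformUnit : κ.map (cdf κ) = uniformUnit := by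
  have hmeas : Measurable (cdf κ) := (monotone_cdf κ).measurable
  have : IsProbabilityMeasure (κ.map (cdf κ)) :=
    Measure.isProbabilityMeasure_map hmeas.aemeasurable
  refine Measure.ext_of_Iic _ _ fun t => ?_
  rw [Measure.map_apply hmeas measurableSet_Iic]
  change κ {y | cdf κ y ≤ t} = _
  rcases lt_or_ge t 1 with h1 | h1
  · rw [measure_cdf_le κ h1, uniformUnit_Iic h1.le]
  · have h : {y | cdf κ y ≤ t} = Set.univ :=
      Set.eq_univ_of_forall fun y => (cdf_le_one κ y).trans h1
    rw [h, measure_univ, uniformUnit, Measure.restrict_apply measurableSet_Iic,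
      Set.inter_eq_right.2 fun y hy => hy.2.trans h1, Real.volume_Icc]
    simp

end CdfTransform

/-! ### Conditional distribution transform -/

section KernelTransform

variable {α : Type*} [MeasurableSpace α] (κ : Kernel α ℝ) [IsMarkovKernel κ]

lemma measurable_cdf_kernel : Measurable fun p : α × ℝ => cdf (κ p.1) p.2 := by
  simp_rw [cdf_eq_real]
  refine Measurable.ennreal_toReal ?_
  exact Kernel.measurable_kernel_prodMk_left (κ := κ.prodMkRight ℝ)
    (t := {q : (α × ℝ) × ℝ | q.2 ≤ q.1.2})
    (measurableSet_le measurable_snd (measurable_snd.comp measurable_fst))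

lemma measurable_kernel_singleton : Measurable fun p : α × ℝ => κ p.1 {p.2} := by
  exact Kernel.measurable_kernel_prodMk_left (κ := κ.prodMkRight ℝ)
    (t := {q : (α × ℝ) × ℝ | q.2 = q.1.2})
    (measurableSet_eq_fun measurable_snd (measurable_snd.comp measurable_fst))

variable {Ω : Type*} [MeasurableSpace Ω] {P : Measure Ω} [IsProbabilityMeasure P]
  {X : Ω → α} {Y : Ω → ℝ}

/-- The conditional distribution transform: if the conditional law of `Y` given `X` is nonatomic,
then its distribution function evaluated at `Y` is uniform and independent of `X`. -/
lemma map_prodMk_cdf_kernel (hX : Measurable X) (hY : Measurable Y)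
    (hκ : P.map X ⊗ₘ κ = P.map fun ω => (X ω, Y ω))
    (hna : ∀ᵐ x ∂P.map X, NullSingletonClass (κ x)) :
    P.map (fun ω => (X ω, cdf (κ (X ω)) (Y ω))) = (P.map X).prod uniformUnit := by
  have hF := measurable_cdf_kernel κ
  have hXY : Measurable fun ω => (X ω, Y ω) := hX.prodMk hY
  have := Measure.isProbabilityMeasure_map (μ := P) hX.aemeasurable
  refine (Measure.prod_eq fun B C hB hC => ?_).symm
  have hG : Measurable fun p : α × ℝ => (p.1, cdf (κ p.1) p.2) := measurable_fst.prodMk hF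
  have hmap : P.map (fun ω => (X ω, cdf (κ (X ω)) (Y ω))) =
      (P.map X ⊗ₘ κ).map fun p : α × ℝ => (p.1, cdf (κ p.1) p.2) := by
    rw [hκ, Measure.map_map hG hXY]; rfl
  rw [hmap, Measure.map_apply hG (hB.prod hC), Measure.compProd_apply (hG (hB.prod hC))]
  calc ∫⁻ x, κ x (Prod.mk x ⁻¹' ((fun p : α × ℝ => (p.1, cdf (κ p.1) p.2)) ⁻¹' B ×ˢ C)) ∂P.map X
      = ∫⁻ x, B.indicator (fun _ => uniformUnit C) x ∂P.map X := by
        refine lintegral_congr_ae ?_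
        filter_upwards [hna] with x hx
        by_cases hxB : x ∈ B
        · rw [Set.indicator_of_mem hxB, ← map_cdf_eq_uniformUnit (κ x),
            Measure.map_apply (monotone_cdf _).measurable hC]
          congr 1; ext y; simp [hxB]
        · rw [Set.indicator_of_notMem hxB]
          convert measure_empty (μ := κ x)
          ext y; simp [hxB]
    _ = _ := by rw [lintegral_indicator_const hB, mul_comm]

lemma map_cdf_kernel (hX : Measurable X) (hY : Measurable Y)
    (hκ : P.map X ⊗ₘ κ = P.map fun ω => (X ω, Y ω))
    (hna : ∀ᵐ x ∂P.map X, NullSingletonClass (κ x)) :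
    P.map (fun ω => cdf (κ (X ω)) (Y ω)) = uniformUnit := by
  have := Measure.isProbabilityMeasure_map (μ := P) hX.aemeasurable
  have hF : Measurable fun ω => cdf (κ (X ω)) (Y ω) :=
    (measurable_cdf_kernel κ).comp (hX.prodMk hY)
  have h := congrArg Measure.snd (map_prodMk_cdf_kernel κ hX hY hκ hna)
  rwa [Measure.snd_prod, Measure.snd_map_prodMk hX] at h

lemma indepFun_cdf_kernel (hX : Measurable X) (hY : Measurable Y)
    (hκ : P.map X ⊗ₘ κ = P.map fun ω => (X ω, Y ω))
    (hna : ∀ᵐ x ∂P.map X, NullSingletonClass (κ x)) :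
    IndepFun X (fun ω => cdf (κ (X ω)) (Y ω)) P := by
  have hF : Measurable fun ω => cdf (κ (X ω)) (Y ω) :=
    (measurable_cdf_kernel κ).comp (hX.prodMk hY)
  rw [indepFun_iff_map_prod_eq_prod_map_map hX.aemeasurable hF.aemeasurable,
    map_cdf_kernel κ hX hY hκ hna, map_prodMk_cdf_kernel κ hX hY hκ hna]

/-- `Y` can be recovered from `X` and the conditional distribution transform. -/
lemma setOf_le_ae_eq_cdf_kernel (hX : Measurable X) (hY : Measurable Y)
    (hκ : P.map X ⊗ₘ κ = P.map fun ω => (X ω, Y ω))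
    (hna : ∀ᵐ x ∂P.map X, NullSingletonClass (κ x)) (q : ℝ) :
    {ω | Y ω ≤ q} =ᵐ[P] {ω | cdf (κ (X ω)) (Y ω) ≤ cdf (κ (X ω)) q} := by
  have hF := measurable_cdf_kernel κ
  have hXY : Measurable fun ω => (X ω, Y ω) := hX.prodMk hY
  have hsub : {ω | Y ω ≤ q} ⊆ {ω | cdf (κ (X ω)) (Y ω) ≤ cdf (κ (X ω)) q} :=
    fun ω hω => monotone_cdf _ hω
  have hS : MeasurableSet {p : α × ℝ | cdf (κ p.1) p.2 ≤ cdf (κ p.1) q} :=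
    measurableSet_le hF (hF.comp (measurable_fst.prodMk measurable_const))
  have hT : MeasurableSet {p : α × ℝ | p.2 ≤ q} := measurableSet_le measurable_snd measurable_const
  -- One inclusion is monotonicity; equality of the conditional masses then makes the difference
  -- null, even where the distribution function is flat.
  refine ae_eq_of_subset_of_measure_ge hsub ?_ (hXY hT).nullMeasurableSet (measure_ne_top _ _)
  change P ((fun ω => (X ω, Y ω)) ⁻¹' {p : α × ℝ | cdf (κ p.1) p.2 ≤ cdf (κ p.1) q}) ≤
    P ((fun ω => (X ω, Y ω)) ⁻¹' {p : α × ℝ | p.2 ≤ q})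
  rw [← Measure.map_apply hXY hS, ← Measure.map_apply hXY hT, ← hκ, Measure.compProd_apply hS,
    Measure.compProd_apply hT]
  refine lintegral_mono_ae ?_
  filter_upwards [hna] with x hx
  have h1 : κ x {y | cdf (κ x) y ≤ cdf (κ x) q} = uniformUnit (Set.Iic (cdf (κ x) q)) := by
    rw [← map_cdf_eq_uniformUnit (κ x), Measure.map_apply (monotone_cdf _).measurable
      measurableSet_Iic]; rfl
  have h2 : κ x {y | y ≤ q} = uniformUnit (Set.Iic (cdf (κ x) q)) := by
    rw [uniformUnit_Iic (cdf_le_one _ _), ofReal_cdf]; rfl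
  exact (h1.trans h2.symm).le

end KernelTransform

/-! ### Generators of sub-σ-fields -/

namespace SubSigmaField

variable {Ω : Type*} [mΩ : MeasurableSpace Ω] {P : Measure Ω}

lemma measurableSet_of_ae_eq {m : MeasurableSpace Ω}
    (hnull : ∀ s : Set Ω, MeasurableSet[mΩ] s → P s = 0 → MeasurableSet[m] s) (hm : m ≤ mΩ)
    {A B : Set Ω} (hA : MeasurableSet[mΩ] A) (hB : MeasurableSet[m] B) (h : A =ᵐ[P] B) :
    MeasurableSet[m] A := by
  obtain ⟨h1, h2⟩ := ae_eq_set.1 h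
  have e : A = (B \ (B \ A)) ∪ (A \ B) := by ext; simp; tauto
  rw [e]
  exact (hB.diff (hnull _ ((hm _ hB).diff hA) h2)).union (hnull _ (hA.diff (hm _ hB)) h1)

/-- The sub-σ-field generated by a random variable and the negligible events. -/
def ofMap {β : Type*} [MeasurableSpace β] (P : Measure Ω) (U : Ω → β) : SubSigmaField P where
  field := @eventuallyMeasurableSpace Ω (MeasurableSpace.comap U inferInstance) (ae P) _ ⊓ mΩ
  le_ambient := inf_le_right
  null_mem _ hs h0 :=
    MeasurableSpace.measurableSet_inf.2 ⟨⟨∅, @MeasurableSet.empty Ω (MeasurableSpace.comap U inferInstance),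
      ae_eq_empty.2 h0⟩, hs⟩

lemma measurableSet_ofMap {β : Type*} [MeasurableSpace β] {U : Ω → β} {A : Set Ω} :
    MeasurableSet[(ofMap P U).field] A ↔
      (∃ C, MeasurableSet C ∧ A =ᵐ[P] U ⁻¹' C) ∧ MeasurableSet A := by
  refine MeasurableSpace.measurableSet_inf.trans (and_congr_left fun _ => ⟨?_, ?_⟩)
  · rintro ⟨_, ⟨C, hC, rfl⟩, h⟩
    exact ⟨C, hC, h⟩
  · rintro ⟨C, hC, h⟩
    exact ⟨_, ⟨C, hC, rfl⟩, h⟩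

/-- A real random variable generating a sub-σ-field up to negligible events. -/
structure IsGenerator (E : SubSigmaField P) (Y : Ω → ℝ) : Prop where
  measurable_field : Measurable[E.field] Y
  exists_preimage : ∀ A, MeasurableSet[E.field] A → ∃ C, MeasurableSet C ∧ A =ᵐ[P] Y ⁻¹' C

lemma IsGenerator.measurable {E : SubSigmaField P} {Y : Ω → ℝ} (h : E.IsGenerator Y) :
    Measurable Y :=
  h.measurable_field.mono E.le_ambient le_rfl

/-- `L2` is separable: measurable versions of a dense sequence, encoded into one real variable,
generate E modulo null sets. -/
lemma exists_isGenerator [IsFiniteMeasure P] [MeasurableSpace.CountablyGenerated Ω]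
    (E : SubSigmaField P) : ∃ Y, E.IsGenerator Y := by
  have : Fact ((2 : ENNReal) ≠ ⊤) := ⟨ENNReal.ofNat_ne_top⟩
  have hf : ∀ j, AEStronglyMeasurable[E.field]
      ((TopologicalSpace.denseSeq E.L2 j : Lp ℝ 2 P) : Ω → ℝ) P := fun j =>
    mem_lpMeas_iff_aestronglyMeasurable.1 (TopologicalSpace.denseSeq E.L2 j).2
  choose f hfm hfe using hf
  let Z : Ω → ℕ → ℝ := fun ω j => f j ω
  have hZ : Measurable[E.field] Z := @measurable_pi_lambda _ _ _ E.field _ _ fun j => (hfm j).measurable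
  have hemb := measurableEmbedding_embeddingReal (ℕ → ℝ)
  refine ⟨fun ω => embeddingReal _ (Z ω), hemb.measurable.comp hZ, fun A hA => ?_⟩
  have hm'le : MeasurableSpace.comap Z inferInstance ≤ mΩ := (measurable_iff_comap_le.1 hZ).trans E.le_ambient
  -- Measurability with respect to the sequence survives L₂ limits, so it passes from the dense
  -- sequence to all of `L2`, indicators included.
  have hcl : IsClosed {g : Lp ℝ 2 P | AEStronglyMeasurable[MeasurableSpace.comap Z inferInstance] g P} := by
    have : Fact ((1 : ENNReal) ≤ 2) := ⟨one_le_two⟩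
    exact isClosed_aestronglyMeasurable hm'le
  have hdense : ∀ g : E.L2, AEStronglyMeasurable[MeasurableSpace.comap Z inferInstance] ((g : Lp ℝ 2 P) : Ω → ℝ) P := by
    intro g
    have hcl' : IsClosed {g : E.L2 | AEStronglyMeasurable[MeasurableSpace.comap Z inferInstance] ((g : Lp ℝ 2 P) : Ω → ℝ) P} :=
      hcl.preimage continuous_subtype_val
    refine hcl'.closure_subset_iff.2 ?_ (TopologicalSpace.denseRange_denseSeq E.L2 g)
    rintro _ ⟨j, rfl⟩
    have hj : Measurable[MeasurableSpace.comap Z inferInstance] (f j) :=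
      (measurable_pi_apply j).comp (comap_measurable Z)
    exact ⟨f j, hj.stronglyMeasurable, hfe j⟩
  obtain ⟨h, hh, he⟩ := hdense ⟨indicatorConstLp 2 (E.le_ambient _ hA) (measure_ne_top P A) (1 : ℝ),
    mem_lpMeas_indicatorConstLp E.le_ambient hA (measure_ne_top P A)⟩
  obtain ⟨C, hC, hCe⟩ := hh.measurable (measurableSet_singleton (1 : ℝ))
  refine ⟨embeddingReal _ '' C, hemb.measurableSet_image.2 hC, ?_⟩
  have hpre : (fun ω => embeddingReal (ℕ → ℝ) (Z ω)) ⁻¹' (embeddingReal _ '' C) = h ⁻¹' {1} := by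
    rw [← hCe]
    exact congrArg (Z ⁻¹' ·) (Set.preimage_image_eq C hemb.injective)
  rw [hpre]
  have h1 := indicatorConstLp_coeFn (p := 2) (hs := E.le_ambient _ hA) (hμs := measure_ne_top P A)
    (c := (1 : ℝ))
  filter_upwards [he, h1] with ω h2 h3
  apply propext
  change ω ∈ A ↔ h ω = 1
  rw [← h2, h3]
  by_cases hω : ω ∈ A <;> simp [hω]

section

variable {E : SubSigmaField P} {Y : Ω → ℝ}

/-- Conditioning on a sub-σ-field is conditioning on a generator. -/
lemma IsGenerator.condExp_ae_eq [IsFiniteMeasure P] (hY : E.IsGenerator Y) {f : Ω → ℝ}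
    (hf : Integrable f P) :
    P[f | E.field] =ᵐ[P] P[f | MeasurableSpace.comap Y inferInstance] := by
  have hle : MeasurableSpace.comap Y inferInstance ≤ E.field :=
    measurable_iff_comap_le.1 hY.measurable_field
  have hle' : MeasurableSpace.comap Y inferInstance ≤ mΩ := hle.trans E.le_ambient
  refine (ae_eq_condExp_of_forall_setIntegral_eq E.le_ambient hf
    (fun _ _ _ => integrable_condExp.integrableOn) (fun s hs _ => ?_)
    (stronglyMeasurable_condExp.mono hle).aestronglyMeasurable).symm
  obtain ⟨C, hC, hsC⟩ := hY.exists_preimage s hs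
  rw [setIntegral_congr_set hsC, setIntegral_congr_set hsC,
    setIntegral_condExp hle' hf ⟨C, hC, rfl⟩]

/-- A generator of a nonatomic sub-σ-field has a nonatomic law. -/
lemma Nonatomic.nullSingletonClass_map (hE : E.Nonatomic) (hY : E.IsGenerator Y) :
    NullSingletonClass (P.map Y) := by
  refine ⟨fun y => ?_⟩
  rw [Measure.map_apply hY.measurable (measurableSet_singleton y)]
  by_contra h
  obtain ⟨B, hB, hBs, hB0, hBlt⟩ :=
    hE _ (hY.measurable_field (measurableSet_singleton y)) (pos_iff_ne_zero.2 h)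
  obtain ⟨C, hC, hBC⟩ := hY.exists_preimage B hB
  have hBC' : B =ᵐ[P] (Y ⁻¹' C ∩ Y ⁻¹' {y} : Set Ω) := by
    have := hBC.inter (ae_eq_refl (Y ⁻¹' {y}))
    rwa [Set.inter_eq_left.2 hBs] at this
  by_cases hy : y ∈ C
  · rw [← Set.preimage_inter, Set.inter_eq_right.2 (Set.singleton_subset_iff.2 hy)] at hBC'
    exact hBlt.ne (measure_congr hBC')
  · rw [← Set.preimage_inter, Set.inter_singleton_eq_empty.2 hy, Set.preimage_empty] at hBC'
    exact hB0.ne' (by rw [measure_congr hBC', measure_empty])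

/-- An atom A would have null intersection with every preimage of probability below P(A); countably
many such preimages cover Ω up to a null set. -/
lemma nonatomic_ofMap [IsProbabilityMeasure P] {U : Ω → ℝ} (hU : Measurable U)
    (hlaw : P.map U = uniformUnit) : (ofMap P U).Nonatomic := by
  intro A hA hA0
  have hAm := (ofMap P U).le_ambient _ hA
  have hUm : ∀ C, MeasurableSet C → MeasurableSet[(ofMap P U).field] (U ⁻¹' C) :=
    fun C hC => measurableSet_ofMap.2 ⟨⟨C, hC, ae_eq_refl _⟩, hU hC⟩
  by_contra hcon
  push Not at hcon
  have hdich : ∀ C, MeasurableSet C → P (A ∩ U ⁻¹' C) = 0 ∨ P A ≤ P (U ⁻¹' C) := by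
    intro C hC
    rcases eq_or_ne (P (A ∩ U ⁻¹' C)) 0 with h | h
    · exact Or.inl h
    · exact Or.inr ((hcon _ (hA.inter (hUm C hC)) Set.inter_subset_left
        (pos_iff_ne_zero.2 h)).trans (measure_mono Set.inter_subset_right))
  obtain ⟨N, hN⟩ := ENNReal.exists_inv_nat_lt hA0.ne'
  have hN0 : 0 < (N : ℝ) := by
    rcases Nat.eq_zero_or_pos N with rfl | h
    · simp at hN
    · exact_mod_cast h
  have hzero : ∀ i : ℕ, P (A ∩ U ⁻¹' Set.Ioc (i / N : ℝ) ((i + 1) / N)) = 0 := by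
    intro i
    refine (hdich _ measurableSet_Ioc).resolve_right (not_le.2 (lt_of_le_of_lt ?_ hN))
    rw [← Measure.map_apply hU measurableSet_Ioc, hlaw, uniformUnit]
    refine (Measure.restrict_apply_le _ _).trans ?_
    rw [Real.volume_Ioc, ← sub_div, add_sub_cancel_left, one_div,
      ENNReal.ofReal_inv_of_pos hN0, ENNReal.ofReal_natCast]
  have hout : P (U ⁻¹' (Set.Ioi 0)ᶜ) = 0 := by
    rw [← Measure.map_apply hU measurableSet_Ioi.compl, hlaw, Set.compl_Ioi,
      uniformUnit_Iic zero_le_one, ENNReal.ofReal_zero]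
  refine hA0.ne' (measure_mono_null (t := U ⁻¹' (Set.Ioi 0)ᶜ ∪
    ⋃ i : ℕ, A ∩ U ⁻¹' Set.Ioc (i / N : ℝ) ((i + 1) / N)) (fun ω hω => ?_)
    (measure_union_null hout (measure_iUnion_null hzero)))
  by_cases h0 : 0 < U ω
  · right
    have hc : 0 < ⌈U ω * N⌉₊ := Nat.ceil_pos.2 (mul_pos h0 hN0)
    obtain ⟨i, hi⟩ := Nat.exists_eq_succ_of_ne_zero hc.ne'
    have h1 : U ω * N ≤ (i + 1 : ℕ) := (Nat.le_ceil _).trans_eq (by rw [hi])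
    have h2 : (i : ℝ) < U ω * N := Nat.lt_ceil.1 (by omega)
    refine Set.mem_iUnion.2 ⟨i, hω, ?_, ?_⟩
    · exact (div_lt_iff₀ hN0).2 h2
    · rw [le_div_iff₀ hN0]; exact_mod_cast h1
  · left; exact h0

/-- Independence of generators gives independence of the generated sub-σ-fields. -/
lemma IsGenerator.indep_ofMap {X U : Ω → ℝ} (hX : E.IsGenerator X) (h : IndepFun X U P) :
    Indep E.field (ofMap P U).field P := by
  rw [Indep_iff]
  intro A B hA hB
  obtain ⟨C, hC, hAC⟩ := hX.exists_preimage A hA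
  obtain ⟨⟨D, hD, hBD⟩, -⟩ := measurableSet_ofMap.1 hB
  rw [measure_congr (hAC.inter hBD), measure_congr hAC, measure_congr hBD]
  exact h.measure_inter_preimage_eq_mul _ _ hC hD

/-- If the conditional law of a generator of `E₂` given a generator of `E₁ ⊆ E₂` is nonatomic, then
`E₂ | E₁` is nonatomic. -/
lemma nonatomicOver_of_condDistrib [IsProbabilityMeasure P] {E₁ E₂ : SubSigmaField P}
    (hle : E₁.field ≤ E₂.field) {X Y : Ω → ℝ} (hX : E₁.IsGenerator X) (hY : E₂.IsGenerator Y)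
    (hna : ∀ᵐ x ∂P.map X, NullSingletonClass (condDistrib Y X P x)) :
    NonatomicOver E₂ E₁ := by
  set κ := condDistrib Y X P with hκdef
  have hκ : P.map X ⊗ₘ κ = P.map fun ω => (X ω, Y ω) :=
    compProd_map_condDistrib hY.measurable.aemeasurable
  set U : Ω → ℝ := fun ω => cdf (κ (X ω)) (Y ω) with hUdef
  have hU₂ : Measurable[E₂.field] U := (measurable_cdf_kernel κ).comp
    ((hX.measurable_field.mono hle le_rfl).prodMk hY.measurable_field)
  have hU : Measurable U := hU₂.mono E₂.le_ambient le_rfl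
  refine ⟨ofMap P U, nonatomic_ofMap hU (map_cdf_kernel κ hX.measurable hY.measurable hκ hna),
    hX.indep_ofMap (indepFun_cdf_kernel κ hX.measurable hY.measurable hκ hna),
    le_antisymm (sup_le hle fun A hA => ?_) fun A hA => ?_⟩
  · obtain ⟨⟨C, hC, hAC⟩, hAm⟩ := measurableSet_ofMap.1 hA
    exact measurableSet_of_ae_eq E₂.null_mem E₂.le_ambient hAm (hU₂ hC) hAC
  · have hmle : E₁.field ⊔ (ofMap P U).field ≤ mΩ := sup_le E₁.le_ambient (ofMap P U).le_ambient
    have hle₁ : E₁.field ≤ E₁.field ⊔ (ofMap P U).field := le_sup_left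
    have hnull : ∀ s : Set Ω, MeasurableSet[mΩ] s → P s = 0 →
        MeasurableSet[E₁.field ⊔ (ofMap P U).field] s :=
      fun s hs h0 => hle₁ _ (E₁.null_mem _ hs h0)
    have hUm : Measurable[E₁.field ⊔ (ofMap P U).field] U := fun C hC =>
      (le_sup_right : (ofMap P U).field ≤ E₁.field ⊔ (ofMap P U).field) _
        (measurableSet_ofMap.2 ⟨⟨C, hC, ae_eq_refl _⟩, hU hC⟩)
    have hYm : Measurable[E₁.field ⊔ (ofMap P U).field] Y := by
      refine measurable_of_Iic fun q => ?_
      refine measurableSet_of_ae_eq hnull hmle (hY.measurable measurableSet_Iic) ?_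
        (setOf_le_ae_eq_cdf_kernel κ hX.measurable hY.measurable hκ hna q)
      exact measurableSet_le hUm ((measurable_cdf_kernel κ).comp
        ((hX.measurable_field.mono hle₁ le_rfl).prodMk measurable_const))
    obtain ⟨C, hC, hAC⟩ := hY.exists_preimage A hA
    exact measurableSet_of_ae_eq hnull hmle (E₂.le_ambient _ hA) (hYm hC) hAC

end

end SubSigmaField

/-! ### Conditional energy and its continuity -/

namespace SubSigmaField

variable {Ω : Type*} [mΩ : MeasurableSpace Ω] {P : Measure Ω}

/-- The second moment of the conditional probability of an event. -/
noncomputable def condEnergy (E : SubSigmaField P) (A : Set Ω) : ℝ :=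
  ∫ ω, (P[A.indicator (fun _ => (1 : ℝ)) | E.field] ω) ^ 2 ∂P

lemma norm_sq_eq_integral_sq (g : Lp ℝ 2 P) : ‖g‖ ^ 2 = ∫ ω, (g ω) ^ 2 ∂P := by
  rw [← real_inner_self_eq_norm_sq, L2.inner_def]
  simp [sq]

lemma infDist_L2 (E : SubSigmaField P) (g : Lp ℝ 2 P) :
    Metric.infDist g (E.L2 : Set (Lp ℝ 2 P)) ^ 2 =
      ‖g‖ ^ 2 - ‖(condExpL2 ℝ ℝ E.le_ambient g : Lp ℝ 2 P)‖ ^ 2 := by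
  have : Fact (E.field ≤ mΩ) := ⟨E.le_ambient⟩
  have h1 : Metric.infDist g (E.L2 : Set (Lp ℝ 2 P)) =
      ‖g - (lpMeas ℝ ℝ E.field 2 P).starProjection g‖ := by
    rw [Submodule.starProjection_minimal, Metric.infDist_eq_iInf]
    simp_rw [dist_eq_norm]
    rfl
  have h2 := (lpMeas ℝ ℝ E.field 2 P).norm_sq_eq_add_norm_sq_starProjection g
  rw [Submodule.starProjection_orthogonal] at h2
  rw [h1, h2]
  change _ = _ - ‖(lpMeas ℝ ℝ E.field 2 P).starProjection g‖ ^ 2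
  simp

/-- Since 0 lies in `L2`, the distance is at most 1, so the truncation in `wijsmanDist` is inactive.
-/
lemma continuous_infDist_L2 {g : Lp ℝ 2 P} (hg : ‖g‖ ≤ 1) :
    Continuous fun E : SubSigmaField P => Metric.infDist g (E.L2 : Set (Lp ℝ 2 P)) := by
  have hle : ∀ E : SubSigmaField P, Metric.infEDist g (E.L2 : Set (Lp ℝ 2 P)) ≤ 1 := fun E =>
    (Metric.infEDist_le_edist_of_mem E.L2.zero_mem).trans (by
      rw [edist_dist, dist_zero_right]; exact ENNReal.ofReal_le_one.2 hg)
  have hc : Continuous fun E : SubSigmaField P => Metric.infEDist g (E.L2 : Set (Lp ℝ 2 P)) := by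
    have h : Continuous fun E : SubSigmaField P => wijsmanDist (E.L2 : Set (Lp ℝ 2 P)) g := by
      have hi : Continuous fun E : SubSigmaField P => wijsmanDist (E.L2 : Set (Lp ℝ 2 P)) :=
        continuous_induced_dom
      exact (continuous_apply (A := fun _ : Lp ℝ 2 P => ENNReal) g).comp hi
    refine h.congr fun E => min_eq_right (hle E)
  exact continuous_iff_continuousAt.2 fun E =>
    (ENNReal.tendsto_toReal ((hle E).trans_lt ENNReal.one_lt_top).ne).comp (hc.tendsto E)

lemma continuous_condEnergy [IsProbabilityMeasure P] {A : Set Ω} (hA : MeasurableSet A) :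
    Continuous fun E : SubSigmaField P => E.condEnergy A := by
  have hf : MemLp (A.indicator fun _ => (1 : ℝ)) 2 P :=
    memLp_indicator_const 2 hA 1 (Or.inr (measure_ne_top P A))
  have hnorm : ‖hf.toLp‖ ≤ 1 := by
    have h : hf.toLp = indicatorConstLp 2 hA (measure_ne_top P A) (1 : ℝ) := rfl
    rw [h]
    refine norm_indicatorConstLp_le.trans ?_
    rw [norm_one, one_mul]
    exact Real.rpow_le_one measureReal_nonneg measureReal_le_one (by positivity)
  have h : ∀ E : SubSigmaField P, E.condEnergy A =
      ‖hf.toLp‖ ^ 2 - Metric.infDist hf.toLp (E.L2 : Set (Lp ℝ 2 P)) ^ 2 := by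
    intro E
    rw [infDist_L2, sub_sub_cancel, norm_sq_eq_integral_sq]
    refine integral_congr_ae ?_
    filter_upwards [hf.condExpL2_ae_eq_condExp (𝕜 := ℝ) E.le_ambient] with ω hω
    rw [hω]
  simp_rw [h]
  exact continuous_const.sub ((continuous_infDist_L2 hnorm).pow 2)

lemma condEnergy_of_measurableSet [IsFiniteMeasure P] {E : SubSigmaField P} {A : Set Ω}
    (hA : MeasurableSet[E.field] A) : E.condEnergy A = P.real A := by
  have hAm := E.le_ambient _ hA
  rw [condEnergy, condExp_of_stronglyMeasurable E.le_ambient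
    (stronglyMeasurable_const.indicator hA) ((integrable_const _).indicator hAm),
    ← integral_indicator_one hAm]
  refine integral_congr_ae (ae_of_all _ fun ω => ?_)
  by_cases h : ω ∈ A <;> simp [h]

lemma condEnergy_of_indep [IsProbabilityMeasure P] {E E' : SubSigmaField P} {A : Set Ω}
    (hA : MeasurableSet[E'.field] A) (h : Indep E.field E'.field P) :
    E.condEnergy A = P.real A ^ 2 := by
  have hi : ∫ ω, A.indicator (fun _ => (1 : ℝ)) ω ∂P = P.real A :=
    integral_indicator_one (E'.le_ambient _ hA)
  have hc := condExp_indep_eq (f := A.indicator fun _ => (1 : ℝ)) E'.le_ambient E.le_ambient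
    (stronglyMeasurable_const.indicator hA) h.symm
  rw [condEnergy, integral_congr_ae (g := fun _ => P.real A ^ 2)]
  · simp
  · filter_upwards [hc] with ω hω
    rw [hω, hi]

end SubSigmaField

/-! ### Atoms of the conditional law and the energy criterion -/

namespace SubSigmaField

variable {Ω : Type*} [mΩ : MeasurableSpace Ω] {P : Measure Ω}

lemma mul_real_singleton_le_integral {κ : Measure ℝ} [IsProbabilityMeasure κ] {G : ℝ → ℝ}
    (hG : Measurable G) (h0 : ∀ y, 0 ≤ G y) (h1 : ∀ y, G y ≤ 1) (y : ℝ) :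
    κ.real {y} * G y ≤ ∫ z, G z ∂κ := by
  have hint : Integrable G κ := Integrable.of_bound hG.aestronglyMeasurable 1
    (ae_of_all _ fun z => by rw [Real.norm_of_nonneg (h0 z)]; exact h1 z)
  calc κ.real {y} * G y = ∫ z in {y}, G z ∂κ := by rw [integral_singleton, smul_eq_mul]
    _ ≤ _ := setIntegral_le_integral hint (ae_of_all _ h0)

/-- The expected squared mass of the atom of the conditional law of `Y` given `X` that `Y` hits is
controlled by the defect of the conditional energies of any finite disjoint family of events. -/
lemma integral_sq_atom_le [StandardBorelSpace Ω] [IsProbabilityMeasure P]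
    {E₁ E₂ : SubSigmaField P} (hle : E₁.field ≤ E₂.field) {X Y : Ω → ℝ}
    (hX : E₁.IsGenerator X) (hY : E₂.IsGenerator Y) {N : ℕ} {A : Fin N → Set Ω}
    (hA : ∀ i, MeasurableSet (A i)) (hdisj : Pairwise (Function.onFun Disjoint A)) :
    ∫ ω, (condDistrib Y X P (X ω)).real {Y ω} ^ 2 ∂P ≤
      1 - ∑ i, (E₂.condEnergy (A i) - E₁.condEnergy (A i)) := by
  have : Nonempty Ω := nonempty_of_isProbabilityMeasure P
  set κ := condDistrib Y X P with hκ
  -- G i (Y) and H i (X) are versions of P(A i | E₂) and P(A i | E₁); H i averages G i over the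
  -- conditional law of Y.
  let G : Fin N → ℝ → ℝ := fun i y => (condDistrib id Y P y).real (A i)
  have hGm : ∀ i, Measurable (G i) := fun i => (Kernel.measurable_coe _ (hA i)).ennreal_toReal
  have hG0 : ∀ i y, 0 ≤ G i y := fun i y => measureReal_nonneg
  have hG1 : ∀ i y, G i y ≤ 1 := fun i y => measureReal_le_one
  have hGsum : ∀ y, ∑ i, G i y ≤ 1 := fun y => by
    rw [← measureReal_iUnion_fintype hdisj hA]
    exact measureReal_le_one
  let H : Fin N → ℝ → ℝ := fun i x => ∫ y, G i y ∂κ x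
  have hHm : ∀ i, Measurable (H i) := fun i =>
    (((hGm i).stronglyMeasurable.comp_measurable measurable_snd).integral_condDistrib
      (f := fun p : ℝ × ℝ => G i p.2)).measurable
  have hH0 : ∀ i x, 0 ≤ H i x := fun i x => integral_nonneg (hG0 i)
  have hGκ : ∀ i x, Integrable (G i) (κ x) := fun i x =>
    Integrable.of_bound (hGm i).aestronglyMeasurable 1
      (ae_of_all _ fun z => by rw [Real.norm_of_nonneg (hG0 i z)]; exact hG1 i z)
  have hH1 : ∀ i x, H i x ≤ 1 := fun i x => by
    calc H i x ≤ ∫ _, (1 : ℝ) ∂κ x := integral_mono (hGκ i x) (integrable_const 1) (hG1 i)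
      _ = 1 := by simp
  have hind : ∀ i, Integrable ((A i).indicator fun _ => (1 : ℝ)) P := fun i =>
    (integrable_const _).indicator (hA i)
  have hE₂ : ∀ i, P[(A i).indicator (fun _ => (1 : ℝ)) | E₂.field] =ᵐ[P] fun ω => G i (Y ω) :=
    fun i => (hY.condExp_ae_eq (hind i)).trans
      (condDistrib_ae_eq_condExp hY.measurable measurable_id (hA i)).symm
  have bdd : ∀ {f : Ω → ℝ}, Measurable f → (∀ ω, 0 ≤ f ω) → (∀ ω, f ω ≤ 1) → Integrable f P :=
    fun hm h0 h1 => Integrable.of_bound hm.aestronglyMeasurable 1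
      (ae_of_all _ fun z => by rw [Real.norm_of_nonneg (h0 z)]; exact h1 z)
  have bdd2 : ∀ {f : Ω → ℝ}, Measurable f → (∀ ω, 0 ≤ f ω) → (∀ ω, f ω ≤ 1) →
      Integrable (fun ω => f ω ^ 2) P :=
    fun hm h0 h1 => bdd (hm.pow_const 2) (fun ω => sq_nonneg _)
      fun ω => pow_le_one₀ (h0 ω) (h1 ω)
  have hE₁ : ∀ i, P[(A i).indicator (fun _ => (1 : ℝ)) | E₁.field] =ᵐ[P] fun ω => H i (X ω) := by
    intro i
    have hGi := bdd ((hGm i).comp hY.measurable) (fun ω => hG0 i _) (fun ω => hG1 i _)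
    exact (condExp_condExp_of_le hle E₂.le_ambient).symm.trans
      ((condExp_congr_ae (hE₂ i)).trans ((hX.condExp_ae_eq hGi).trans
        (condExp_ae_eq_integral_condDistrib hX.measurable hY.measurable.aemeasurable
          (hGm i).stronglyMeasurable hGi)))
  have e₂ : ∀ i, E₂.condEnergy (A i) = ∫ ω, G i (Y ω) ^ 2 ∂P := fun i =>
    integral_congr_ae (by filter_upwards [hE₂ i] with ω hω; rw [hω])
  have e₁ : ∀ i, E₁.condEnergy (A i) = ∫ ω, H i (X ω) ^ 2 ∂P := fun i =>
    integral_congr_ae (by filter_upwards [hE₁ i] with ω hω; rw [hω])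
  have ham : Measurable fun ω => (κ (X ω)).real {Y ω} :=
    ((measurable_kernel_singleton κ).comp
      (hX.measurable.prodMk hY.measurable)).ennreal_toReal
  have i₂ : ∀ i, Integrable (fun ω => G i (Y ω) ^ 2) P := fun i =>
    bdd2 ((hGm i).comp hY.measurable) (fun ω => hG0 i _) (fun ω => hG1 i _)
  have i₁ : ∀ i, Integrable (fun ω => H i (X ω) ^ 2) P := fun i =>
    bdd2 ((hHm i).comp hX.measurable) (fun ω => hH0 i _) (fun ω => hH1 i _)
  have i₀ : Integrable (fun ω => ∑ i, (G i (Y ω) ^ 2 - H i (X ω) ^ 2)) P :=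
    integrable_finsetSum _ fun i _ => (i₂ i).sub (i₁ i)
  calc ∫ ω, (κ (X ω)).real {Y ω} ^ 2 ∂P
      ≤ ∫ ω, (1 - ∑ i, (G i (Y ω) ^ 2 - H i (X ω) ^ 2)) ∂P := by
        refine integral_mono (bdd2 ham (fun ω => measureReal_nonneg)
          fun ω => measureReal_le_one) ((integrable_const 1).sub i₀) fun ω => ?_
        set a := (κ (X ω)).real {Y ω} with ha
        have ha0 : 0 ≤ a := measureReal_nonneg
        have ha1 : a ^ 2 ≤ 1 := pow_le_one₀ ha0 measureReal_le_one
        -- The atom at Y alone contributes a · G i (Y) to H i (X). With ∑ G² ≤ 1, this gives ∑ G² -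
        -- ∑ H² ≤ (1 - a²) ∑ G² ≤ 1 - a².
        have hb : a ^ 2 * ∑ i, G i (Y ω) ^ 2 ≤ ∑ i, H i (X ω) ^ 2 := by
          rw [Finset.mul_sum]
          refine Finset.sum_le_sum fun i _ => ?_
          rw [← mul_pow]
          exact pow_le_pow_left₀ (mul_nonneg ha0 (hG0 i _))
            (mul_real_singleton_le_integral (hGm i) (hG0 i) (hG1 i) _) 2
        have hs : ∑ i, G i (Y ω) ^ 2 ≤ 1 :=
          (Finset.sum_le_sum fun i _ => by
            rw [sq]; exact mul_le_of_le_one_left (hG0 i _) (hG1 i _)).trans (hGsum (Y ω))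
        change a ^ 2 ≤ 1 - ∑ i, (G i (Y ω) ^ 2 - H i (X ω) ^ 2)
        rw [Finset.sum_sub_distrib]
        nlinarith
    _ = _ := by
        have hsum := integral_finsetSum (f := fun i ω => G i (Y ω) ^ 2 - H i (X ω) ^ 2)
          Finset.univ fun i _ => (i₂ i).sub (i₁ i)
        rw [integral_sub (integrable_const 1) i₀, hsum]
        simp_rw [fun i => integral_sub (i₂ i) (i₁ i), e₁, e₂]
        simp

/-- Almost surely Y hits no atom of its conditional law; but an atom would be hit with positive
conditional probability. -/
lemma ae_nullSingletonClass_condDistrib [IsProbabilityMeasure P] {X Y : Ω → ℝ}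
    (hX : Measurable X) (hY : Measurable Y)
    (h : ∫ ω, (condDistrib Y X P (X ω)).real {Y ω} ^ 2 ∂P ≤ 0) :
    ∀ᵐ x ∂P.map X, NullSingletonClass (condDistrib Y X P x) := by
  set κ := condDistrib Y X P with hκ
  have hs := measurable_kernel_singleton κ
  have ham : Measurable fun ω => (κ (X ω)).real {Y ω} :=
    (hs.comp (hX.prodMk hY)).ennreal_toReal
  have hint : Integrable (fun ω => (κ (X ω)).real {Y ω} ^ 2) P :=
    Integrable.of_bound (ham.pow_const 2).aestronglyMeasurable 1 (ae_of_all _ fun ω => by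
      rw [Real.norm_of_nonneg (sq_nonneg _)]
      exact pow_le_one₀ measureReal_nonneg measureReal_le_one)
  have h0 := (integral_eq_zero_iff_of_nonneg (fun ω => sq_nonneg _) hint).1
    (le_antisymm h (integral_nonneg fun ω => sq_nonneg _))
  have h1 : ∀ᵐ p ∂(P.map X ⊗ₘ κ), κ p.1 {p.2} = 0 := by
    rw [hκ, compProd_map_condDistrib hY.aemeasurable, ← hκ]
    refine (ae_map_iff (hX.prodMk hY).aemeasurable (hs (measurableSet_singleton 0))).2 ?_
    filter_upwards [h0] with ω hω
    exact (measureReal_eq_zero_iff).1 (pow_eq_zero_iff two_ne_zero |>.1 hω)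
  filter_upwards [Measure.ae_ae_of_ae_compProd h1] with x hx
  refine ⟨fun y => ?_⟩
  by_contra hy
  refine hy (measure_mono_null ?_ hx)
  rintro _ rfl
  exact hy

/-- A nonatomic sub-σ-field contains partitions into equiprobable events. -/
lemma Nonatomic.exists_partition [StandardBorelSpace Ω] [IsProbabilityMeasure P]
    {E : SubSigmaField P} (hE : E.Nonatomic) {N : ℕ} (hN : 0 < N) :
    ∃ A : Fin N → Set Ω, (∀ i, MeasurableSet[E.field] (A i)) ∧
      Pairwise (Function.onFun Disjoint A) ∧ ∀ i, P.real (A i) = 1 / N := by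
  obtain ⟨Y, hY⟩ := E.exists_isGenerator
  have := hE.nullSingletonClass_map hY
  have := Measure.isProbabilityMeasure_map (μ := P) hY.measurable.aemeasurable
  have hF : Measurable (cdf (P.map Y)) := (monotone_cdf _).measurable
  have hN0 : (0 : ℝ) < N := by exact_mod_cast hN
  refine ⟨fun i => (cdf (P.map Y) ∘ Y) ⁻¹' Set.Ioc (i / N : ℝ) ((i + 1) / N),
    fun i => (hF.comp hY.measurable_field) measurableSet_Ioc, fun i j hij => ?_, fun i => ?_⟩
  · refine Disjoint.preimage _ (Set.Ioc_disjoint_Ioc.2 ?_)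
    rcases lt_or_gt_of_ne hij with h | h
    · have : (i : ℝ) + 1 ≤ j := by exact_mod_cast h
      exact (min_le_left _ _).trans ((div_le_div_of_nonneg_right this hN0.le).trans
        (le_max_right _ _))
    · have : (j : ℝ) + 1 ≤ i := by exact_mod_cast h
      exact (min_le_right _ _).trans ((div_le_div_of_nonneg_right this hN0.le).trans
        (le_max_left _ _))
  · have hi : ((i : ℕ) : ℝ) + 1 ≤ N := by exact_mod_cast i.2
    rw [measureReal_def, ← Measure.map_apply (hF.comp hY.measurable) measurableSet_Ioc,
      ← Measure.map_map hF hY.measurable, map_cdf_eq_uniformUnit,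
      uniformUnit_Ioc (by positivity) ((div_le_one hN0).2 hi), ← sub_div, add_sub_cancel_left,
      ENNReal.toReal_ofReal (by positivity)]

/-- `E₂ | E₁` is nonatomic iff finite disjoint families of events have conditional energy defect
arbitrarily close to `1`. -/
lemma nonatomicOver_iff [StandardBorelSpace Ω] [IsProbabilityMeasure P]
    {E₁ E₂ : SubSigmaField P} (hle : E₁.field ≤ E₂.field) :
    NonatomicOver E₂ E₁ ↔ ∀ n : ℕ, ∃ (N : ℕ) (A : Fin N → Set Ω), (∀ i, MeasurableSet (A i)) ∧
      Pairwise (Function.onFun Disjoint A) ∧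
      1 - 1 / ((n : ℝ) + 1) < ∑ i, (E₂.condEnergy (A i) - E₁.condEnergy (A i)) := by
  constructor
  · rintro ⟨E, hE, hind, hsup⟩ n
    -- N = n + 2 events give defect 1 - 1/(n + 2), strictly above the threshold; n + 1 would only
    -- reach it.
    obtain ⟨A, hA, hdisj, hP⟩ := hE.exists_partition (N := n + 2) (by omega)
    refine ⟨n + 2, A, fun i => E.le_ambient _ (hA i), hdisj, ?_⟩
    have hle₂ : E.field ≤ E₂.field := hsup ▸ le_sup_right
    have h : ∀ i, E₂.condEnergy (A i) - E₁.condEnergy (A i) =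
        1 / ((n : ℝ) + 2) - (1 / ((n : ℝ) + 2)) ^ 2 := fun i => by
      rw [condEnergy_of_measurableSet (hle₂ _ (hA i)), condEnergy_of_indep (hA i) hind, hP]
      push_cast; rfl
    simp_rw [h]
    rw [Finset.sum_const, Finset.card_univ, Fintype.card_fin, nsmul_eq_mul]
    have e : ((n + 2 : ℕ) : ℝ) * (1 / ((n : ℝ) + 2) - (1 / ((n : ℝ) + 2)) ^ 2) =
        1 - 1 / ((n : ℝ) + 2) := by
      push_cast; field_simp
    rw [e]
    exact sub_lt_sub_left (one_div_lt_one_div_of_lt (by positivity) (by linarith)) 1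
  · intro h
    obtain ⟨X, hX⟩ := E₁.exists_isGenerator
    obtain ⟨Y, hY⟩ := E₂.exists_isGenerator
    refine nonatomicOver_of_condDistrib hle hX hY
      (ae_nullSingletonClass_condDistrib hX.measurable hY.measurable ?_)
    refine ge_of_tendsto' tendsto_one_div_add_atTop_nhds_zero_nat fun n => ?_
    obtain ⟨N, A, hA, hdisj, hn⟩ := h n
    linarith [integral_sq_atom_le hle hX hY hA hdisj]

end SubSigmaField

/-! ### The Gδ property -/

theorem lemma4p12 {Ω : Type*} [MeasurableSpace Ω] [StandardBorelSpace Ω]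
    (P : Measure Ω) [IsProbabilityMeasure P] [NullSingletonClass P] :
    IsGδ {p : PairSpace P | SubSigmaField.NonatomicOver p.1.2 p.1.1} := by
  have h : {p : PairSpace P | SubSigmaField.NonatomicOver p.1.2 p.1.1} =
      ⋂ n : ℕ, {p : PairSpace P | ∃ (N : ℕ) (A : Fin N → Set Ω), (∀ i, MeasurableSet (A i)) ∧
        Pairwise (Function.onFun Disjoint A) ∧ 1 - 1 / ((n : ℝ) + 1) <
          ∑ i, (p.1.2.condEnergy (A i) - p.1.1.condEnergy (A i))} := by
    ext p
    rw [Set.mem_iInter]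
    exact SubSigmaField.nonatomicOver_iff p.2.1
  rw [h]
  refine IsGδ.iInter fun n => IsOpen.isGδ ?_
  simp only [Set.ofPred_exists]
  refine isOpen_iUnion fun N => isOpen_iUnion fun A => ?_
  -- The conditions on the family do not involve p: if they fail, the set is empty.
  by_cases hA : (∀ i, MeasurableSet (A i)) ∧ Pairwise (Function.onFun Disjoint A)
  · simp only [hA.1, hA.2, implies_true, true_and]
    refine isOpen_lt continuous_const (continuous_finsetSum _ fun i _ => ?_)
    have hc := SubSigmaField.continuous_condEnergy (P := P) (hA.1 i)
    exact (hc.comp (continuous_snd.comp continuous_subtype_val)).sub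
      (hc.comp (continuous_fst.comp continuous_subtype_val))
  · convert isOpen_empty
    ext p
    simp only [Set.mem_ofPred_eq, Set.mem_empty_iff_false, iff_false]
    exact fun hp => hA ⟨hp.1, hp.2.1⟩
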